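/- Let $n \ge 0$ and let $\mathbb{Z}_2^n$ act on $\mathbb{R}^n$ in the standard way, by sign changes of the coordinates. A smooth action of $\mathbb{Z}_2^n$ on a smooth $n$-manifold $M$ is called locally standard if every point of $M$ has an invariant open neighbourhood that is diffeomorphic, equivariantly up to an automorphism of $\mathbb{Z}_2^n$, to an invariant open subset of $\mathbb{R}^n$. A small cover over the $n$-cube $I^n = [0,1]^n$ is a smooth closed $n$-manifold $M$ with a locally standard $\mathbb{Z}_2^n$-action whose orbit space is homeomorphic to $I^n$ as a manifold with corners, i.e. there is a homeomorphism $M/\mathbb{Z}_2^n \to I^n$ under which the orbits with isotropy group of rank $k$ correspond to the points lying in the relative interior of a face of codimension $k$. A digraph has at most one edge from $i$ to $j$ for each ordered pair $(i,j)$ of nodes, and is acyclic if it has no directed cycle of any length (in particular, no loop). Then there are only finitely many homeomorphism classes of (total spaces of) small covers over $I^n$, and their number is at most the number of acyclic digraphs with $n$ unlabeled nodes, that is, of acyclic digraphs on the node set $\{1,\dots,n\}$ up to relabeling of the nodes. -/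

import Mathlib

open scoped Manifold ContDiff

universe u

/-! ### Small covers over the cube -/

/-- The group `ℤ₂ⁿ`, written additively. -/
abbrev Z2Pow (n : ℕ) : Type := Fin n → ZMod 2

/-- The standard action of `ℤ₂ⁿ` on `ℝⁿ` by sign changes of the coordinates:
the `i`-th coordinate of `v` is multiplied by `(-1) ^ (t i)`. -/
noncomputable def standardAct {n : ℕ} (t : Z2Pow n) (v : EuclideanSpace ℝ (Fin n)) :
    EuclideanSpace ℝ (Fin n) :=
  WithLp.toLp 2 fun i => if t i = 0 then v i else -v i

/-- A locally standard action of `ℤ₂ⁿ` on a smooth `n`-manifold `M`: every point has an invariant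
open neighbourhood (the source of `e`) that is diffeomorphic to an open subset of `ℝⁿ`
(smooth charts are the elements of the maximal atlas), the diffeomorphism being equivariant, up to
an automorphism `φ` of `ℤ₂ⁿ`, for the standard action on `ℝⁿ`. -/
def IsLocallyStandard (n : ℕ) (M : Type u) [TopologicalSpace M]
    [ChartedSpace (EuclideanSpace ℝ (Fin n)) M] [AddAction (Z2Pow n) M] : Prop :=
  ∀ x : M, ∃ e ∈ IsManifold.maximalAtlas (𝓡 n) ∞ M, ∃ φ : Z2Pow n ≃+ Z2Pow n,
    x ∈ e.source ∧
    ∀ y ∈ e.source, ∀ t : Z2Pow n,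
      t +ᵥ y ∈ e.source ∧ e (t +ᵥ y) = standardAct (φ t) (e y)

/-- The cube `Iⁿ`, with its product topology. -/
abbrev UnitCube (n : ℕ) : Type := Fin n → unitInterval

/-- The codimension of the minimal face of `Iⁿ` containing `p`, that is, the number of facets
`{p | p i = 0}`, `{p | p i = 1}` of the cube that contain `p`. -/
noncomputable def faceCodim {n : ℕ} (p : UnitCube n) : ℕ :=
  Set.ncard {i : Fin n | p i = 0 ∨ p i = 1}

/-- The orbit space of the action is the cube `Iⁿ`, as a (topological) manifold with corners: there
is a homeomorphism `h` from the orbit space to `Iⁿ` that carries the codimension `k` stratum onto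
the union of the relative interiors of the codimension `k` faces. For a locally standard action the
codimension of an orbit in the orbit space is the number of vanishing coordinates in a standard
chart, i.e. the rank `k` of the isotropy group, which therefore has `2 ^ k` elements. -/
def OrbitSpaceIsCube (n : ℕ) (M : Type u) [TopologicalSpace M] [AddAction (Z2Pow n) M] : Prop :=
  ∃ h : AddAction.orbitRel.Quotient (Z2Pow n) M ≃ₜ UnitCube n,
    ∀ x : M, Nat.card (AddAction.stabilizer (Z2Pow n) x) =
      2 ^ faceCodim (h (Quotient.mk (AddAction.orbitRel (Z2Pow n) M) x))

/-- A small cover over `Iⁿ`: a closed (compact Hausdorff, without boundary) smooth `n`-manifold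
with a smooth locally standard action of `ℤ₂ⁿ` whose orbit space is `Iⁿ`. -/
structure SmallCover (n : ℕ) : Type (u + 1) where
  carrier : Type u
  [topologicalSpace : TopologicalSpace carrier]
  [t2Space : T2Space carrier]
  [compactSpace : CompactSpace carrier]
  [chartedSpace : ChartedSpace (EuclideanSpace ℝ (Fin n)) carrier]
  [isManifold : IsManifold (𝓡 n) ∞ carrier]
  [addAction : AddAction (Z2Pow n) carrier]
  smooth_act : ∀ t : Z2Pow n, ContMDiff (𝓡 n) (𝓡 n) ∞ (fun x : carrier => t +ᵥ x)
  locallyStandard : IsLocallyStandard n carrier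
  orbitSpace : OrbitSpaceIsCube n carrier

attribute [instance] SmallCover.topologicalSpace

/-- Two small covers are identified when their underlying spaces are homeomorphic. -/
instance SmallCover.homeoSetoid (n : ℕ) : Setoid (SmallCover.{u} n) where
  r M N := Nonempty (M.carrier ≃ₜ N.carrier)
  iseqv :=
    ⟨fun M => ⟨Homeomorph.refl M.carrier⟩, fun ⟨f⟩ => ⟨f.symm⟩, fun ⟨f⟩ ⟨g⟩ => ⟨f.trans g⟩⟩

/-- The homeomorphism classes of small covers over `Iⁿ`. -/
abbrev SmallCover.HomeoClass (n : ℕ) : Type (u + 1) :=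
  Quotient (SmallCover.homeoSetoid.{u} n)

/-! ### Acyclic digraphs -/

/-- A digraph is acyclic if it has no directed cycle of any positive length; in particular it has
no loop. -/
def Digraph.IsAcyclic {V : Type*} (G : Digraph V) : Prop :=
  ∀ v : V, ¬ Relation.TransGen G.Adj v v

/-- Acyclic digraphs on the `n` labeled nodes `Fin n`. -/
abbrev AcyclicDigraph (n : ℕ) : Type := {G : Digraph (Fin n) // G.IsAcyclic}

/-- Two digraphs on `n` nodes are identified when they differ by a relabeling of the nodes. -/
instance AcyclicDigraph.relabelSetoid (n : ℕ) : Setoid (AcyclicDigraph n) where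
  r G H := ∃ σ : Equiv.Perm (Fin n), ∀ i j : Fin n, G.1.Adj i j ↔ H.1.Adj (σ i) (σ j)
  iseqv := by
    refine ⟨fun G => ⟨Equiv.refl _, fun i j => Iff.rfl⟩, ?_, ?_⟩
    · rintro G H ⟨σ, h⟩
      exact ⟨σ.symm, fun i j => by simp [h]⟩
    · rintro G H K ⟨σ, h⟩ ⟨τ, k⟩
      exact ⟨σ.trans τ, fun i j => by simp [h, k]⟩

/-- The acyclic digraphs on `n` unlabeled nodes. -/
abbrev UnlabeledAcyclicDigraph (n : ℕ) : Type :=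
  Quotient (AcyclicDigraph.relabelSetoid n)

open Set Filter Topology

/-! ### Orbit maps onto the cube -/

/-! The orbit map of a small cover `M` has a continuous section `s` (`exists_section`), so `M` is
`Iⁿ × ℤ₂ⁿ` with `(p, t)` and `(p, t')` glued when `t - t'` fixes `s p`. Isotropy is constant along
each open facet, where it is generated by one vector, and the isotropy at `s p` is the span of the
vectors of the facets through `p` (`exists_charSpan`). Hence these `2n` vectors determine `M` up to
homeomorphism.

At a vertex the isotropy is everything. At the vertex `0` this allows a change of basis making the
vector of `{p | p i = 0}` the `i`-th basis vector; the vectors of the opposite facets then form the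
rows of a matrix over `𝔽₂`. The other vertices force its diagonal to be `1` and its off-diagonal
part to be the adjacency matrix of an acyclic digraph: a chordless cycle would yield a linear
functional killing all the vectors at some vertex (`isAcyclic_digraphOfChar`).

Relabeling the nodes permutes the coordinates and does not change the space, so choosing a digraph
for each homeomorphism class gives an injection into unlabeled acyclic digraphs. -/

/-- A map identifying the orbit space of an action of `ℤ₂ⁿ` with the cube `Iⁿ`, stratum by stratum,
where the action is topologically locally standard. -/
structure IsCubeOrbitMap {n : ℕ} {M : Type u} [TopologicalSpace M] [AddAction (Z2Pow n) M]
    (π : M → UnitCube n) : Prop where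
  isOpenQuotientMap : IsOpenQuotientMap π
  apply_eq_iff : ∀ {x y : M}, π x = π y ↔ x ∈ AddAction.orbit (Z2Pow n) y
  card_stabilizer : ∀ x : M,
    Nat.card (AddAction.stabilizer (Z2Pow n) x) = 2 ^ faceCodim (π x)
  exists_chart : ∀ x : M, ∃ e : OpenPartialHomeomorph M (EuclideanSpace ℝ (Fin n)),
    ∃ φ : Z2Pow n ≃+ Z2Pow n, x ∈ e.source ∧
      ∀ y ∈ e.source, ∀ t : Z2Pow n,
        t +ᵥ y ∈ e.source ∧ e (t +ᵥ y) = standardAct (φ t) (e y)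

/-- Finitely many closed fibres are also open. This makes group elements chosen pointwise constant
on connected sets. -/
theorem exists_forall_eq_of_isClosed_fiber {X ι : Type*} [TopologicalSpace X] [PreconnectedSpace X]
    [Finite ι] [Nonempty ι] (τ : X → ι) (h : ∀ i, IsClosed (τ ⁻¹' {i})) :
    ∃ i, ∀ x, τ x = i := by
  have hloc : IsLocallyConstant τ := by
    refine (IsLocallyConstant.iff_isOpen_fiber).2 fun i => ?_
    have : τ ⁻¹' {i} = (⋃ j ∈ ({i}ᶜ : Set ι), τ ⁻¹' {j})ᶜ := by
      ext x
      simp only [mem_preimage, mem_singleton_iff, mem_compl_iff, mem_iUnion, exists_prop, not_exists,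
        not_and]
      exact ⟨fun h j hj e => hj (e.symm.trans h), fun h => by_contra fun hne => h _ hne rfl⟩
    rw [this]
    exact ((Set.toFinite _).isClosed_biUnion fun j _ => h j).isOpen_compl
  obtain ⟨i, hi⟩ := hloc.exists_eq_const
  exact ⟨i, fun x => congrFun hi x⟩

theorem standardAct_apply {n : ℕ} (t : Z2Pow n) (v : EuclideanSpace ℝ (Fin n)) (i : Fin n) :
    standardAct t v i = if t i = 0 then v i else -v i := rfl

/-- The coordinatewise absolute value. -/
noncomputable def coordAbs {n : ℕ} (v : EuclideanSpace ℝ (Fin n)) : EuclideanSpace ℝ (Fin n) :=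
  WithLp.toLp 2 fun i => |v i|

theorem continuous_coordAbs {n : ℕ} : Continuous (coordAbs (n := n)) := by
  unfold coordAbs
  fun_prop

theorem coordAbs_standardAct {n : ℕ} (t : Z2Pow n) (v : EuclideanSpace ℝ (Fin n)) :
    coordAbs (standardAct t v) = coordAbs v := by
  ext i
  simp only [coordAbs, standardAct_apply]
  split_ifs <;> simp

theorem exists_standardAct_eq_coordAbs {n : ℕ} (v : EuclideanSpace ℝ (Fin n)) :
    ∃ t : Z2Pow n, standardAct t v = coordAbs v := by
  refine ⟨fun i => if v i < 0 then 1 else 0, ?_⟩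
  ext i
  simp only [coordAbs, standardAct_apply]
  by_cases h : v i < 0
  · simp [h, abs_of_neg h]
  · simp [h, abs_of_nonneg (not_lt.1 h)]

theorem standardAct_eq_self_iff {n : ℕ} (t : Z2Pow n) (v : EuclideanSpace ℝ (Fin n)) :
    standardAct t v = v ↔ ∀ i, t i = 0 ∨ v i = 0 := by
  constructor
  · intro h i
    have := congrArg (fun w : EuclideanSpace ℝ (Fin n) => w i) h
    simp only [standardAct_apply] at this
    split_ifs at this with h0
    · exact Or.inl h0
    · right; linarith
  · intro h
    ext i
    simp only [standardAct_apply]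
    split_ifs with h0
    · rfl
    · simp [(h i).resolve_left h0]

/-! ### The interior of the cube and a global section. -/

/-- The embedding of `ℝⁿ` onto the interior of the cube. -/
noncomputable def cubeSigmoid (n : ℕ) : (Fin n → ℝ) → UnitCube n :=
  Pi.map fun _ => unitInterval.sigmoid

theorem cubeSigmoid_apply {n : ℕ} (x : Fin n → ℝ) (i : Fin n) :
    cubeSigmoid n x i = unitInterval.sigmoid (x i) := rfl

theorem closure_Ioo_unitInterval : closure (Ioo (0 : unitInterval) 1) = univ := by
  rw [closure_Ioo zero_ne_one]
  ext x; simp [unitInterval.le_one']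

theorem isDenseInducing_cubeSigmoid (n : ℕ) : IsDenseInducing (cubeSigmoid n) where
  toIsInducing := (IsEmbedding.piMap fun _ => isEmbedding_sigmoid).toIsInducing
  dense := DenseRange.piMap fun _ => by
    rw [DenseRange, unitInterval.range_sigmoid, dense_iff_closure_eq, closure_Ioo_unitInterval]

theorem isPreconnected_cubeSigmoid_preimage_ball {n : ℕ} (p : UnitCube n) {r : ℝ} (hr : 0 < r) :
    IsPreconnected (cubeSigmoid n ⁻¹' Metric.ball p r) := by
  have : cubeSigmoid n ⁻¹' Metric.ball p r =
      univ.pi fun i => unitInterval.sigmoid ⁻¹' Metric.ball (p i) r := by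
    ext x
    simp [ball_pi _ hr, cubeSigmoid_apply]
  rw [this]
  refine isPreconnected_univ_pi fun i => OrdConnected.isPreconnected ?_
  have hb : (Metric.ball (p i) r).OrdConnected := by
    have : Metric.ball (p i) r = Subtype.val ⁻¹' Metric.ball (p i : ℝ) r := rfl
    rw [this, Real.ball_eq_Ioo]
    exact ordConnected_Ioo.preimage_mono (Subtype.mono_coe _)
  exact hb.preimage_mono unitInterval.sigmoid_monotone

theorem faceCodim_eq_zero {n : ℕ} {p : UnitCube n} (h : ∀ i, p i ∈ Ioo (0 : unitInterval) 1) :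
    faceCodim p = 0 := by
  have : {i : Fin n | p i = 0 ∨ p i = 1} = ∅ := by
    ext i
    simp [(h i).1.ne', (h i).2.ne]
  rw [faceCodim, this, ncard_empty]

namespace IsCubeOrbitMap

variable {n : ℕ} {M : Type u} [TopologicalSpace M] [AddAction (Z2Pow n) M] {π : M → UnitCube n}

theorem apply_vadd (hπ : IsCubeOrbitMap π) (t : Z2Pow n) (x : M) : π (t +ᵥ x) = π x :=
  hπ.apply_eq_iff.2 ⟨t, rfl⟩

theorem exists_vadd_eq (hπ : IsCubeOrbitMap π) {x y : M} (h : π x = π y) :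
    ∃ t : Z2Pow n, t +ᵥ y = x :=
  hπ.apply_eq_iff.1 h

theorem stabilizer_eq (hπ : IsCubeOrbitMap π) {x y : M} (h : π x = π y) :
    AddAction.stabilizer (Z2Pow n) x = AddAction.stabilizer (Z2Pow n) y := by
  obtain ⟨g, rfl⟩ := hπ.exists_vadd_eq h
  ext t
  rw [AddAction.mem_stabilizer_iff, AddAction.mem_stabilizer_iff, vadd_vadd, add_comm, ← vadd_vadd,
    vadd_left_cancel_iff]

theorem stabilizer_eq_bot (hπ : IsCubeOrbitMap π) {x : M}
    (h : ∀ i, π x i ∈ Ioo (0 : unitInterval) 1) : AddAction.stabilizer (Z2Pow n) x = ⊥ := by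
  have := hπ.card_stabilizer x
  rw [faceCodim_eq_zero h, pow_zero] at this
  exact AddSubgroup.card_eq_one.1 this

/-- The orbit map has continuous local sections: in a standard chart, take absolute values of the
coordinates. -/
theorem exists_local_section (hπ : IsCubeOrbitMap π) (p : UnitCube n) :
    ∃ U ∈ 𝓝 p, ∃ σ : UnitCube n → M, ContinuousOn σ U ∧ ∀ q ∈ U, π (σ q) = q := by
  classical
  obtain ⟨x, rfl⟩ := hπ.isOpenQuotientMap.surjective p
  obtain ⟨e, φ, hx, he⟩ := hπ.exists_chart x
  set r : M → M := fun y => e.symm (coordAbs (e y)) with hr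
  have hmem : ∀ y ∈ e.source, coordAbs (e y) ∈ e.target ∧ π (r y) = π y := by
    intro y hy
    obtain ⟨t, ht⟩ := exists_standardAct_eq_coordAbs (e y)
    obtain ⟨h1, h2⟩ := he y hy (φ.symm t)
    rw [φ.apply_symm_apply, ht] at h2
    refine ⟨h2 ▸ e.map_source h1, ?_⟩
    rw [hr]
    simp only
    rw [← h2, e.left_inv h1, hπ.apply_vadd]
  have hU : IsOpen (π '' e.source) := hπ.isOpenQuotientMap.isOpenMap _ e.open_source
  -- The chosen preimage is immaterial, since `r` is constant on orbits inside the chart.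
  let σ : UnitCube n → M := fun q => if h : q ∈ π '' e.source then r h.choose else x
  have hσ : ∀ y ∈ e.source, σ (π y) = r y := by
    intro y hy
    have h : π y ∈ π '' e.source := mem_image_of_mem _ hy
    have h' := h.choose_spec
    obtain ⟨t, ht⟩ := hπ.exists_vadd_eq h'.2
    simp only [σ, dif_pos h, hr]
    rw [← ht, (he y hy t).2, coordAbs_standardAct]
  refine ⟨π '' e.source, hU.mem_nhds (mem_image_of_mem _ hx), σ, ?_, ?_⟩
  · rintro _ ⟨y, hy, rfl⟩
    refine ContinuousAt.continuousWithinAt ?_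
    rw [← hπ.isOpenQuotientMap.continuousAt_comp_iff]
    have hev : σ ∘ π =ᶠ[𝓝 y] r := by
      filter_upwards [e.open_source.mem_nhds hy] with z hz using hσ z hz
    refine ContinuousAt.congr ?_ hev.symm
    exact (e.continuousAt_symm (hmem y hy).1).comp
      (f := fun y => coordAbs (e y)) (continuous_coordAbs.continuousAt.comp (e.continuousAt hy))
  · rintro _ ⟨y, hy, rfl⟩
    rw [hσ y hy, (hmem y hy).2]

variable [T2Space M] [ContinuousConstVAdd (Z2Pow n) M]

/-- Over the interior the action is free, so the translating element is unique and each of its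
fibres is an equalizer, hence closed. -/
theorem exists_eq_vadd_of_preconnected (hπ : IsCubeOrbitMap π) {X : Type*} [TopologicalSpace X]
    [PreconnectedSpace X] {f g : X → M} (hf : Continuous f) (hg : Continuous g)
    (hfg : ∀ x, π (f x) = π (g x)) (hint : ∀ x i, π (g x) i ∈ Ioo (0 : unitInterval) 1) :
    ∃ t : Z2Pow n, ∀ x, f x = t +ᵥ g x := by
  choose τ hτ using fun x => hπ.exists_vadd_eq (hfg x)
  obtain ⟨t, ht⟩ := exists_forall_eq_of_isClosed_fiber τ fun t => by
    have : τ ⁻¹' {t} = {x | t +ᵥ g x = f x} := by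
      ext x
      refine ⟨fun h => by rw [← (h : τ x = t)]; exact hτ x, fun h => ?_⟩
      have h1 : -t + τ x ∈ AddAction.stabilizer (Z2Pow n) (g x) := by
        rw [AddAction.mem_stabilizer_iff, ← vadd_vadd, hτ x, ← (h : t +ᵥ g x = f x), vadd_vadd,
          neg_add_cancel, zero_vadd]
      rw [hπ.stabilizer_eq_bot (hint x), AddSubgroup.mem_bot] at h1
      exact (neg_add_eq_zero.1 h1).symm
    rw [this]
    exact isClosed_eq (hg.const_vadd t) hf
  exact ⟨t, fun x => by rw [← ht x, hτ x]⟩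

/-- The orbit map has a continuous section. -/
theorem exists_section [CompactSpace M] (hπ : IsCubeOrbitMap π) :
    ∃ s : UnitCube n → M, Continuous s ∧ ∀ p, π (s p) = p := by
  have hint : ∀ x i, cubeSigmoid n x i ∈ Ioo (0 : unitInterval) 1 := fun x i =>
    ⟨unitInterval.sigmoid_pos _, unitInterval.sigmoid_lt_one _⟩
  have hdi := isDenseInducing_cubeSigmoid n
  obtain ⟨e₀, he₀⟩ := hπ.isOpenQuotientMap.surjective (cubeSigmoid n 0)
  -- Over the interior `π` is a covering map, so `cubeSigmoid` lifts to `M` because `ℝⁿ` is simply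
  -- connected.
  have hcov := hπ.isOpenQuotientMap.isQuotientMap.isCoveringMapOn_of_properlyDiscontinuousVAdd
    hπ.apply_eq_iff
  obtain ⟨F, ⟨-, hF⟩, -⟩ := hcov.existsUnique_continuousMap_lifts
    ⟨cubeSigmoid n, hdi.continuous⟩ (a₀ := 0) he₀ (fun a => by
      obtain ⟨y, hy⟩ := hπ.isOpenQuotientMap.surjective (cubeSigmoid n a)
      exact ⟨y, hπ.stabilizer_eq_bot (by rw [hy]; exact hint a), hy⟩)
  have hF' : ∀ x, π (F x) = cubeSigmoid n x := fun x => congrFun hF x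
  -- Near any point of the cube, the lift is a fixed translate of a local section, so it has a limit
  -- even at the boundary.
  have hlim : ∀ p, ∃ y, Tendsto F (comap (cubeSigmoid n) (𝓝 p)) (𝓝 y) := by
    intro p
    obtain ⟨U, hU, σ, hσ, hπσ⟩ := hπ.exists_local_section p
    obtain ⟨r, hr, hrU⟩ := Metric.mem_nhds_iff.1 hU
    have hpre := isPreconnected_iff_preconnectedSpace.1
      (isPreconnected_cubeSigmoid_preimage_ball p hr)
    obtain ⟨t, ht⟩ := hπ.exists_eq_vadd_of_preconnected
      (X := cubeSigmoid n ⁻¹' Metric.ball p r)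
      (f := fun x => F x) (g := fun x => σ (cubeSigmoid n x))
      (F.continuous.comp continuous_subtype_val)
      (hσ.comp_continuous (hdi.continuous.comp continuous_subtype_val) fun x => hrU x.2)
      (fun x => by rw [hF', hπσ _ (hrU x.2)])
      (fun x => by rw [hπσ _ (hrU x.2)]; exact hint x)
    refine ⟨t +ᵥ σ p, ?_⟩
    have h1 : Tendsto (fun x => t +ᵥ σ (cubeSigmoid n x)) (comap (cubeSigmoid n) (𝓝 p))
        (𝓝 (t +ᵥ σ p)) :=
      (((hσ.continuousAt hU).tendsto.comp tendsto_comap)).const_vadd t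
    refine h1.congr' ?_
    filter_upwards [preimage_mem_comap (Metric.ball_mem_nhds p hr)] with x hx
    exact (ht ⟨x, hx⟩).symm
  refine ⟨hdi.extend F, hdi.continuous_extend hlim, fun p => ?_⟩
  refine congrFun (hdi.dense.equalizer
    (hπ.isOpenQuotientMap.continuous.comp (hdi.continuous_extend hlim)) continuous_id ?_) p
  ext1 x
  simp only [Function.comp_apply, id]
  rw [hdi.extend_eq F.continuous, hF']

end IsCubeOrbitMap

/-! ### Facets and isotropy groups. -/

/-- The relative interior of the facet `{p | p i = c}` of the cube. -/
def facetInterior {n : ℕ} (i : Fin n) (c : unitInterval) : Set (UnitCube n) :=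
  univ.pi (Function.update (fun _ => Ioo (0 : unitInterval) 1) i {c})

theorem isPreconnected_facetInterior {n : ℕ} (i : Fin n) (c : unitInterval) :
    IsPreconnected (facetInterior i c) := by
  refine isPreconnected_univ_pi fun j => ?_
  by_cases h : j = i
  · subst h; simpa using isPreconnected_singleton
  · simpa [h] using isPreconnected_Ioo

theorem mem_facetInterior_iff {n : ℕ} {i : Fin n} {c : unitInterval} {p : UnitCube n} :
    p ∈ facetInterior i c ↔ p i = c ∧ ∀ j, j ≠ i → p j ∈ Ioo (0 : unitInterval) 1 := by
  rw [facetInterior, mem_univ_pi]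
  refine ⟨fun h => ⟨by simpa using h i, fun j hj => by simpa [hj] using h j⟩, fun h j => ?_⟩
  by_cases hj : j = i
  · subst hj; simpa using h.1
  · simpa [hj] using h.2 j hj

theorem mem_closure_facetInterior {n : ℕ} (p : UnitCube n) (i : Fin n) :
    p ∈ closure (facetInterior i (p i)) := by
  rw [facetInterior, closure_pi_set, mem_univ_pi]
  intro j
  by_cases hj : j = i
  · subst hj; simp
  · simp only [Function.update_of_ne hj, closure_Ioo_unitInterval, mem_univ]

theorem mem_Ioo_unitInterval_iff {a : unitInterval} :
    a ∈ Ioo (0 : unitInterval) 1 ↔ ¬ (a = 0 ∨ a = 1) := by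
  rw [mem_Ioo, unitInterval.pos_iff_ne_zero, unitInterval.lt_one_iff_ne_one, not_or]

theorem mem_facetInterior_of_setOf_eq {n : ℕ} {i : Fin n} {p : UnitCube n}
    (h : {j : Fin n | p j = 0 ∨ p j = 1} = {i}) : p ∈ facetInterior i (p i) := by
  refine mem_facetInterior_iff.2 ⟨rfl, fun j hj => mem_Ioo_unitInterval_iff.2 fun hj' => hj ?_⟩
  have : j ∈ {j : Fin n | p j = 0 ∨ p j = 1} := hj'
  rwa [h] at this

theorem faceCodim_of_mem_facetInterior {n : ℕ} {i : Fin n} {c : unitInterval} (hc : c = 0 ∨ c = 1)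
    {p : UnitCube n} (hp : p ∈ facetInterior i c) : faceCodim p = 1 := by
  rw [mem_facetInterior_iff] at hp
  have : {j : Fin n | p j = 0 ∨ p j = 1} = {i} := by
    ext j
    refine ⟨fun hj => by_contra fun hji => mem_Ioo_unitInterval_iff.1 (hp.2 j hji) hj, ?_⟩
    rintro rfl
    rw [mem_ofPred_eq, hp.1]
    exact hc
  rw [faceCodim, this, ncard_singleton]

/-- The span of the characteristic vectors of the facets through `p`; `l i c` is the vector of the
facet `{p | p i = c}` if `c = 0` or `c = 1`, and it is meant to vanish otherwise. -/
def charSpan {n : ℕ} (l : Fin n → unitInterval → Z2Pow n) (p : UnitCube n) :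
    Submodule (ZMod 2) (Z2Pow n) :=
  Submodule.span (ZMod 2) (range fun i => l i (p i))

theorem mem_of_forall_single_mem {n : ℕ} (K : AddSubgroup (Z2Pow n)) {t : Z2Pow n}
    (h : ∀ i, t i ≠ 0 → Pi.single i 1 ∈ K) : t ∈ K := by
  rw [← Finset.univ_sum_single t]
  refine K.sum_mem fun i _ => ?_
  by_cases hi : t i = 0
  · rw [hi, Pi.single_zero]; exact K.zero_mem
  · rw [show t i = 1 from Fin.eq_one_of_ne_zero _ hi]
    exact h i hi

/-- A small perturbation of a vector makes all nonzero those coordinates which are not required to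
vanish. -/
theorem exists_perturbation {n : ℕ} (v : EuclideanSpace ℝ (Fin n)) {i : Fin n} (hi : v i = 0)
    {N : Set (EuclideanSpace ℝ (Fin n))} (hN : N ∈ 𝓝 v) : ∃ w ∈ N, ∀ j, w j = 0 ↔ j = i := by
  classical
  let w : ℝ → EuclideanSpace ℝ (Fin n) := fun ε =>
    WithLp.toLp 2 fun j => if j = i then 0 else if v j = 0 then ε else v j
  have hw : Continuous w := by
    refine (PiLp.continuous_toLp 2 _).comp (continuous_pi fun j => ?_)
    split_ifs <;> fun_prop
  have hw0 : w 0 = v := by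
    ext j
    simp only [w]
    split_ifs with h1 h2
    · rw [h1, hi]
    · exact h2.symm
    · rfl
  have hev : ∀ᶠ ε in 𝓝[>] (0 : ℝ), w ε ∈ N :=
    (hw.tendsto 0).mono_left nhdsWithin_le_nhds (by rwa [hw0])
  obtain ⟨ε, hε, hε0⟩ := (hev.and self_mem_nhdsWithin).exists
  refine ⟨w ε, hε, fun j => ?_⟩
  have hε' : ε ≠ 0 := (mem_Ioi.1 hε0).ne'
  simp only [w]
  split_ifs with h1 h2 <;> simp_all

namespace IsCubeOrbitMap

variable {n : ℕ} {M : Type u} [TopologicalSpace M] [AddAction (Z2Pow n) M] {π : M → UnitCube n}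

/-- Over an open facet each stabilizer has order two. Its nonzero element is constant because fixing
`s q` is a closed condition and the open facet is connected. -/
theorem exists_facet_vector [T2Space M] [ContinuousConstVAdd (Z2Pow n) M] (hπ : IsCubeOrbitMap π)
    {s : UnitCube n → M} (hs : Continuous s) (hπs : ∀ p, π (s p) = p) (i : Fin n)
    (c : unitInterval) (hc : c = 0 ∨ c = 1) :
    ∃ l : Z2Pow n, ∀ x, π x ∈ facetInterior i c →
      ∀ t, t ∈ AddAction.stabilizer (Z2Pow n) x ↔ t = 0 ∨ t = l := by
  have key : ∀ q : facetInterior i c, ∃ t : Z2Pow n, t ≠ 0 ∧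
      ∀ u, u ∈ AddAction.stabilizer (Z2Pow n) (s q) ↔ u = 0 ∨ u = t := by
    rintro ⟨q, hq⟩
    have hcard := hπ.card_stabilizer (s q)
    rw [hπs, faceCodim_of_mem_facetInterior hc hq, pow_one, Nat.card_eq_two_iff' 0] at hcard
    obtain ⟨t, ht, huniq⟩ := hcard
    refine ⟨t, fun h => ht (Subtype.ext h), fun u => ⟨fun hu => ?_, ?_⟩⟩
    · by_cases hu0 : u = 0
      · exact Or.inl hu0
      · exact Or.inr (congrArg Subtype.val (huniq ⟨u, hu⟩ fun h => hu0 (congrArg Subtype.val h)))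
    · rintro (rfl | rfl)
      · exact zero_mem _
      · exact t.2
  choose τ hτ0 hτ using key
  have := isPreconnected_iff_preconnectedSpace.1 (isPreconnected_facetInterior i c)
  obtain ⟨l, hl⟩ := exists_forall_eq_of_isClosed_fiber τ fun t => by
    by_cases ht : t = 0
    · have : τ ⁻¹' {t} = ∅ := by
        ext q
        simp [ht, hτ0 q]
      rw [this]
      exact isClosed_empty
    · have : τ ⁻¹' {t} = {q : facetInterior i c | t +ᵥ s q = s q} := by
        ext q
        rw [mem_ofPred_eq, ← AddAction.mem_stabilizer_iff, hτ, or_iff_right ht]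
        exact eq_comm
      rw [this]
      exact isClosed_eq ((hs.comp continuous_subtype_val).const_vadd t)
        (hs.comp continuous_subtype_val)
  refine ⟨l, fun x hx t => ?_⟩
  rw [hπ.stabilizer_eq (hπs (π x)).symm, hτ ⟨π x, hx⟩, hl]

/-- Near any point, the isotropy groups are generated by those of the nearby codimension one
points. -/
theorem exists_of_mem_chart (hπ : IsCubeOrbitMap π)
    {e : OpenPartialHomeomorph M (EuclideanSpace ℝ (Fin n))} {φ : Z2Pow n ≃+ Z2Pow n}
    (he : ∀ y ∈ e.source, ∀ t : Z2Pow n,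
        t +ᵥ y ∈ e.source ∧ e (t +ᵥ y) = standardAct (φ t) (e y))
    {x : M} (hx : x ∈ e.source) {N : Set M} (hN : N ∈ 𝓝 x) {i : Fin n} (hi : e x i = 0) :
    ∃ y ∈ N, faceCodim (π y) = 1 ∧
      φ.symm (Pi.single i 1) ∈ AddAction.stabilizer (Z2Pow n) y := by
  have hN' : e.target ∩ e.symm ⁻¹' N ∈ 𝓝 (e x) := by
    refine inter_mem (e.open_target.mem_nhds (e.map_source hx)) ?_
    exact (e.continuousAt_symm (e.map_source hx)) (by rwa [e.left_inv hx])
  obtain ⟨w, ⟨hwt, hwN⟩, hw⟩ := exists_perturbation (e x) hi hN'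
  have hys : e.symm w ∈ e.source := e.map_target hwt
  have hst : ∀ t, t ∈ AddAction.stabilizer (Z2Pow n) (e.symm w) ↔ ∀ j, j ≠ i → φ t j = 0 := by
    intro t
    obtain ⟨h1, h2⟩ := he _ hys t
    rw [AddAction.mem_stabilizer_iff, ← e.injOn.eq_iff h1 hys, h2, e.right_inv hwt,
      standardAct_eq_self_iff]
    refine forall_congr' fun j => ?_
    rw [hw, or_iff_not_imp_right]
  have hφ : ∀ t, t ∈ AddAction.stabilizer (Z2Pow n) (e.symm w) ↔
      t = 0 ∨ t = φ.symm (Pi.single i 1) := by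
    intro t
    rw [hst]
    constructor
    · intro h
      have ht : φ t = Pi.single i (φ t i) := by
        ext1 j
        by_cases hj : j = i
        · subst hj; simp
        · simp [hj, h j hj]
      by_cases h0 : φ t i = 0
      · left
        rw [h0, Pi.single_zero] at ht
        exact φ.map_eq_zero_iff.1 ht
      · right
        rw [show φ t i = 1 from Fin.eq_one_of_ne_zero _ h0] at ht
        rw [← ht, φ.symm_apply_apply]
    · rintro (rfl | rfl) j hj
      · simp
      · simp [hj]
  refine ⟨e.symm w, hwN, ?_, (hφ _).2 (Or.inr rfl)⟩
  have hcard : Nat.card (AddAction.stabilizer (Z2Pow n) (e.symm w)) = 2 := by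
    rw [Nat.card_eq_two_iff' 0]
    refine ⟨⟨_, (hφ _).2 (Or.inr rfl)⟩, ?_, ?_⟩
    · intro h
      have := congrArg Subtype.val h
      simp at this
    · rintro ⟨t, ht⟩ ht0
      exact Subtype.ext (((hφ t).1 ht).resolve_left fun h => ht0 (Subtype.ext h))
  rw [hπ.card_stabilizer] at hcard
  exact Nat.pow_right_injective le_rfl (by simpa using hcard)

/-- The isotropy groups are spanned by the characteristic vectors of the facets. -/
theorem exists_charSpan [T2Space M] [ContinuousConstVAdd (Z2Pow n) M] (hπ : IsCubeOrbitMap π)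
    {s : UnitCube n → M} (hs : Continuous s) (hπs : ∀ p, π (s p) = p) :
    ∃ l : Fin n → unitInterval → Z2Pow n, (∀ i c, ¬ (c = 0 ∨ c = 1) → l i c = 0) ∧
      ∀ p t, t ∈ AddAction.stabilizer (Z2Pow n) (s p) ↔ t ∈ charSpan l p := by
  classical
  choose l' hl' using hπ.exists_facet_vector hs hπs
  let l : Fin n → unitInterval → Z2Pow n := fun i c => if hc : c = 0 ∨ c = 1 then l' i c hc else 0
  refine ⟨l, fun i c hc => dif_neg hc, fun p t => ⟨fun ht => ?_, fun ht => ?_⟩⟩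
  · obtain ⟨e, φ, hx, he⟩ := hπ.exists_chart (s p)
    -- In the chart, `φ t` can flip only coordinates that vanish at `s p`, so it suffices to treat
    -- the corresponding basis vectors.
    have hsupp : ∀ i, φ t i ≠ 0 → e (s p) i = 0 := fun i hi => by
      rw [AddAction.mem_stabilizer_iff] at ht
      have h := (he _ hx t).2
      rw [ht] at h
      exact ((standardAct_eq_self_iff _ _).1 h.symm i).resolve_left hi
    have hmem : φ t ∈ (charSpan l p).toAddSubgroup.map φ.toAddMonoidHom := by
      refine mem_of_forall_single_mem _ fun i hi => ?_
      -- Points of `N` lie over no facets other than those through `p`.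
      let N : Set M := {y | ∀ j, (π y j = 0 ∨ π y j = 1) → π y j = p j}
      have hN : N ∈ 𝓝 (s p) := by
        rw [show N = ⋂ j, {y | (π y j = 0 ∨ π y j = 1) → π y j = p j} by ext; simp [N], iInter_mem]
        intro j
        have hcont : Continuous fun y => π y j :=
          (continuous_apply j).comp hπ.isOpenQuotientMap.continuous
        have hfin : ({0, 1} \ {p j} : Set unitInterval)ᶜ ∈ 𝓝 (π (s p) j) := by
          refine ((Set.toFinite _).isClosed.isOpen_compl).mem_nhds ?_
          simp [hπs]
        filter_upwards [hcont.continuousAt hfin] with y hy h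
        by_contra hne
        exact hy ⟨h, hne⟩
      obtain ⟨y, hyN, hy1, hyst⟩ := hπ.exists_of_mem_chart he hx hN (hsupp i hi)
      obtain ⟨k, hk⟩ := ncard_eq_one.1 hy1
      have hk' : π y k = 0 ∨ π y k = 1 := by
        have : k ∈ {j : Fin n | π y j = 0 ∨ π y j = 1} := by rw [hk]; rfl
        exact this
      have h2 := ((hl' k _ hk' y (mem_facetInterior_of_setOf_eq hk) _).1 hyst).resolve_left (by simp)
      refine ⟨φ.symm (Pi.single i 1), ?_, φ.apply_symm_apply _⟩
      refine Submodule.subset_span ⟨k, ?_⟩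
      simp only [← hyN k hk', l]
      rw [dif_pos hk', h2]
    obtain ⟨t', ht', h⟩ := hmem
    rwa [← φ.injective h]
  · have hle : charSpan l p ≤
        AddSubgroup.toZModSubmodule 2 (AddAction.stabilizer (Z2Pow n) (s p)) := by
      refine Submodule.span_le.2 ?_
      rintro _ ⟨i, rfl⟩
      change l i (p i) ∈ AddAction.stabilizer (Z2Pow n) (s p)
      by_cases hc : p i = 0 ∨ p i = 1
      -- The facet vector fixes `s` on the open facet, hence on its closure, which contains `p`.
      · have hcl : IsClosed {q | l i (p i) +ᵥ s q = s q} := isClosed_eq (hs.const_vadd _) hs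
        refine hcl.closure_subset_iff.2 (fun q hq => ?_) (mem_closure_facetInterior p i)
        refine (hl' i _ hc (s q) (by rwa [hπs]) _).2 (Or.inr ?_)
        exact dif_pos hc
      · rw [show l i (p i) = 0 from dif_neg hc]
        exact zero_mem _
    exact hle ht

end IsCubeOrbitMap

/-! ### Characteristic vectors and acyclic digraphs -/

/-- The characteristic vectors attached to a digraph: the facet `{p | p i = 0}` carries the `i`-th
basis vector and the facet `{p | p i = 1}` the indicator of `i` and its out-neighbours. -/
noncomputable def Digraph.charVector {n : ℕ} (G : Digraph (Fin n)) (i : Fin n) (c : unitInterval) :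
    Z2Pow n :=
  open scoped Classical in
  if c = 0 then Pi.single i 1 else if c = 1 then fun j => if j = i ∨ G.Adj i j then 1 else 0 else 0

/-- The digraph of a family of characteristic vectors. -/
def digraphOfChar {n : ℕ} (l : Fin n → unitInterval → Z2Pow n) : Digraph (Fin n) where
  Adj i j := i ≠ j ∧ l i 1 j = 1

/-- A minimal such set is a union of chordless cycles: by minimality a successor function `f` is a
permutation of it, and a second successor of `i` would allow `f i` to be removed. -/
theorem exists_unique_outNeighbor {V : Type*} [Finite V] {r : V → V → Prop}
    (h : ∃ S : Finset V, S.Nonempty ∧ ∀ i ∈ S, ∃ j ∈ S, r i j) :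
    ∃ S : Finset V, S.Nonempty ∧ ∀ i ∈ S, ∃ j ∈ S, r i j ∧ ∀ k ∈ S, r i k → k = j := by
  classical
  have := Fintype.ofFinite V
  obtain ⟨S, hS⟩ := exists_minimal_of_wellFoundedLT _ h
  obtain ⟨⟨hne, hout⟩, hmin⟩ := hS
  choose! f hfS hf using hout
  have himg : S.image f = S := by
    refine le_antisymm (Finset.image_subset_iff.2 hfS) (hmin ⟨hne.image f, ?_⟩
      (Finset.image_subset_iff.2 hfS))
    intro j hj
    obtain ⟨i, hi, rfl⟩ := Finset.mem_image.1 hj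
    exact ⟨_, Finset.mem_image_of_mem f (hfS i hi), hf _ (hfS i hi)⟩
  have hinj : Set.InjOn f S := Finset.card_image_iff.1 (by rw [himg])
  refine ⟨S, hne, fun i hi => ⟨f i, hfS i hi, hf i hi, fun k hk hik => by_contra fun hki => ?_⟩⟩
  have hsub : S ≤ S.erase (f i) := by
    refine hmin ⟨⟨k, Finset.mem_erase.2 ⟨hki, hk⟩⟩, fun j hj => ?_⟩ (Finset.erase_subset _ _)
    obtain ⟨-, hjS⟩ := Finset.mem_erase.1 hj
    by_cases hji : j = i
    · subst hji
      exact ⟨k, Finset.mem_erase.2 ⟨hki, hk⟩, hik⟩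
    · exact ⟨f j, Finset.mem_erase.2 ⟨fun h => hji (hinj hjS hi h), hfS j hjS⟩, hf j hjS⟩
  exact Finset.notMem_erase _ _ (hsub (hfS i hi))

/-- The vertex of the cube whose coordinates equal to `1` are those in `S`. -/
def cubeVertex {n : ℕ} (S : Finset (Fin n)) : UnitCube n := fun i => if i ∈ S then 1 else 0

/-- Otherwise all the vectors at the vertex `{i}` have `i`-th coordinate zero. -/
theorem apply_self_eq_one_of_charSpan_eq_top {n : ℕ} {l : Fin n → unitInterval → Z2Pow n}
    (h0 : ∀ i, l i 0 = Pi.single i 1) (htop : ∀ S, charSpan l (cubeVertex S) = ⊤) (i : Fin n) :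
    l i 1 i = 1 := by
  by_contra hne
  have h : l i 1 i = 0 := by
    by_contra h; exact hne (Fin.eq_one_of_ne_zero _ h)
  have hle : charSpan l (cubeVertex {i}) ≤ LinearMap.ker (LinearMap.proj (R := ZMod 2) i) := by
    refine Submodule.span_le.2 ?_
    rintro _ ⟨j, rfl⟩
    simp only [SetLike.mem_coe, LinearMap.mem_ker, LinearMap.proj_apply, cubeVertex,
      Finset.mem_singleton]
    split_ifs with hj
    · rw [hj, h]
    · rw [h0, Pi.single_eq_of_ne (Ne.symm hj)]
  rw [htop] at hle
  have := hle (Submodule.mem_top (x := (Pi.single i 1 : Z2Pow n)))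
  simp at this

theorem isAcyclic_digraphOfChar {n : ℕ} {l : Fin n → unitInterval → Z2Pow n}
    (h0 : ∀ i, l i 0 = Pi.single i 1) (htop : ∀ S, charSpan l (cubeVertex S) = ⊤) :
    (digraphOfChar l).IsAcyclic := by
  classical
  intro v hv
  obtain ⟨S, ⟨i₀, hi₀⟩, hS⟩ := exists_unique_outNeighbor (r := (digraphOfChar l).Adj)
    -- Every node leading to `v` has a successor leading to `v`, since `v` lies on a cycle.
    ⟨Finset.univ.filter fun w => Relation.TransGen (digraphOfChar l).Adj w v,
      ⟨v, by simpa using hv⟩, fun i hi => by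
        rw [Finset.mem_filter_univ] at hi
        obtain ⟨j, hij, hj⟩ := Relation.TransGen.head'_iff.1 hi
        refine ⟨j, ?_, hij⟩
        rw [Finset.mem_filter_univ]
        rcases Relation.reflTransGen_iff_eq_or_transGen.1 hj with rfl | h
        · exact hv
        · exact h⟩
  -- The sum of the coordinates in `S` kills every vector at this vertex: for `i ∈ S` exactly two
  -- ones contribute, at `i` and at its only successor in `S`; for `i ∉ S` the vector is the `i`-th
  -- basis vector.
  have hle : charSpan l (cubeVertex S) ≤
      LinearMap.ker (∑ j ∈ S, LinearMap.proj (R := ZMod 2) (φ := fun _ : Fin n => ZMod 2) j) := by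
    refine Submodule.span_le.2 ?_
    rintro _ ⟨i, rfl⟩
    simp only [SetLike.mem_coe, LinearMap.mem_ker, LinearMap.sum_apply, LinearMap.proj_apply,
      cubeVertex]
    split_ifs with hi
    · obtain ⟨j, hj, hij, huniq⟩ := hS i hi
      rw [← Finset.add_sum_erase _ _ hi, ← Finset.add_sum_erase _ _
        (Finset.mem_erase.2 ⟨hij.1.symm, hj⟩), apply_self_eq_one_of_charSpan_eq_top h0 htop, hij.2,
        Finset.sum_eq_zero, add_zero]
      · exact CharTwo.add_self_eq_zero 1
      · intro k hk
        rw [Finset.mem_erase, Finset.mem_erase] at hk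
        by_contra hne
        exact hk.1 (huniq k hk.2.2 ⟨hk.2.1.symm, Fin.eq_one_of_ne_zero _ hne⟩)
    · rw [h0]
      exact Finset.sum_eq_zero fun j hj =>
        Pi.single_eq_of_ne (M := fun _ => ZMod 2) (ne_of_mem_of_not_mem hj hi) 1
  rw [htop] at hle
  have := hle (Submodule.mem_top (x := (Pi.single i₀ 1 : Z2Pow n)))
  simp only [LinearMap.mem_ker, LinearMap.sum_apply, LinearMap.proj_apply, Pi.single_apply,
    Finset.sum_ite_eq', if_pos hi₀] at this
  exact one_ne_zero this

theorem charVector_digraphOfChar {n : ℕ} {l : Fin n → unitInterval → Z2Pow n}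
    (h0 : ∀ i, l i 0 = Pi.single i 1) (h1 : ∀ i, l i 1 i = 1)
    (hl : ∀ i c, ¬ (c = 0 ∨ c = 1) → l i c = 0) : (digraphOfChar l).charVector = l := by
  ext1 i; ext1 c
  rw [Digraph.charVector]
  split_ifs with hc0 hc1
  · rw [hc0, h0]
  · ext1 j
    rw [hc1]
    by_cases hj : j = i
    · rw [if_pos (Or.inl hj), hj, h1]
    · simp only [hj, false_or, digraphOfChar, ne_eq, Ne.symm hj, not_false_eq_true, true_and]
      split_ifs with h
      · exact h.symm
      · by_contra hne
        exact h (Fin.eq_one_of_ne_zero _ (Ne.symm hne))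
  · exact (hl i c (not_or.2 ⟨hc0, hc1⟩)).symm

theorem charSpan_linearEquiv {n : ℕ} (χ : Z2Pow n ≃ₗ[ZMod 2] Z2Pow n)
    (l : Fin n → unitInterval → Z2Pow n) (p : UnitCube n) :
    charSpan (fun i c => χ (l i c)) p = (charSpan l p).map χ.toLinearMap := by
  rw [charSpan, charSpan, Submodule.map_span, ← range_comp]
  rfl

/-! ### Models of small covers -/

/-- `q` presents `M` as the quotient of `Iⁿ × ℤ₂ⁿ` determined by the characteristic vectors `l`. -/
structure IsCubeModel {n : ℕ} {M : Type u} [TopologicalSpace M]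
    (l : Fin n → unitInterval → Z2Pow n) (q : UnitCube n × Z2Pow n → M) : Prop where
  continuous : Continuous q
  surjective : Function.Surjective q
  eq_iff : ∀ a b, q a = q b ↔ a.1 = b.1 ∧ a.2 - b.2 ∈ charSpan l a.1

theorem faceCodim_cubeVertex {n : ℕ} (S : Finset (Fin n)) : faceCodim (cubeVertex S) = n := by
  have : {i : Fin n | cubeVertex S i = 0 ∨ cubeVertex S i = 1} = univ := by
    ext i
    simp only [cubeVertex, mem_ofPred_eq, mem_univ, iff_true]
    split_ifs <;> simp
  rw [faceCodim, this, ncard_univ, Nat.card_eq_fintype_card, Fintype.card_fin]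

theorem IsCubeOrbitMap.exists_model {n : ℕ} {M : Type u} [TopologicalSpace M] [T2Space M]
    [CompactSpace M] [AddAction (Z2Pow n) M] [ContinuousConstVAdd (Z2Pow n) M]
    {π : M → UnitCube n} (hπ : IsCubeOrbitMap π) :
    ∃ G : AcyclicDigraph n, ∃ q : UnitCube n × Z2Pow n → M, IsCubeModel G.1.charVector q := by
  obtain ⟨s, hs, hπs⟩ := hπ.exists_section
  obtain ⟨l, hl, hst⟩ := hπ.exists_charSpan hs hπs
  have htop : ∀ S, charSpan l (cubeVertex S) = ⊤ := by
    intro S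
    have hcard := hπ.card_stabilizer (s (cubeVertex S))
    rw [hπs, faceCodim_cubeVertex] at hcard
    have : AddAction.stabilizer (Z2Pow n) (s (cubeVertex S)) = ⊤ := by
      refine AddSubgroup.eq_top_of_card_eq _ ?_
      rw [hcard]
      simp
    refine (Submodule.eq_top_iff').2 fun t => (hst _ _).1 ?_
    rw [this]
    exact AddSubgroup.mem_top t
  have hb : (⊤ : Submodule (ZMod 2) (Z2Pow n)) ≤ Submodule.span (ZMod 2) (range fun i => l i 0) := by
    rw [← htop ∅]
    exact le_of_eq (by simp [charSpan, cubeVertex])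
  -- The `n` vectors at the vertex `0` span, so they form a basis, and `χ` takes coordinates in it.
  let b := basisOfTopLeSpanOfCardEqFinrank (fun i => l i 0) hb (by simp)
  let χ : Z2Pow n ≃ₗ[ZMod 2] Z2Pow n := b.equivFun
  have hχ : ∀ i, χ (l i 0) = Pi.single i 1 := fun i => by
    have : l i 0 = b i := by simp [b]
    rw [this]
    ext1 j
    simp [χ, Pi.single_apply, eq_comm]
  let l' : Fin n → unitInterval → Z2Pow n := fun i c => χ (l i c)
  have htop' : ∀ S, charSpan l' (cubeVertex S) = ⊤ := fun S => by
    rw [charSpan_linearEquiv, htop, Submodule.map_top, LinearEquiv.range]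
  refine ⟨⟨digraphOfChar l', isAcyclic_digraphOfChar hχ htop'⟩,
    fun a => χ.symm a.2 +ᵥ s a.1, ?_⟩
  rw [charVector_digraphOfChar hχ (apply_self_eq_one_of_charSpan_eq_top hχ htop')
    fun i c hc => by simp only [l', hl i c hc, map_zero]]
  refine ⟨?_, fun x => ?_, ?_⟩
  · exact continuous_prod_of_discrete_right.2 fun t => (continuous_const_vadd (χ.symm t)).comp hs
  · obtain ⟨t, ht⟩ := hπ.exists_vadd_eq (hπs (π x)).symm
    exact ⟨(π x, χ t), by simpa using ht⟩
  · rintro ⟨p, t⟩ ⟨p', t'⟩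
    have key : t - t' ∈ charSpan l' p ↔ χ.symm t +ᵥ s p = χ.symm t' +ᵥ s p := by
      rw [charSpan_linearEquiv, Submodule.mem_map_equiv, ← hst, AddAction.mem_stabilizer_iff,
        map_sub, sub_eq_neg_add, ← vadd_vadd, neg_vadd_eq_iff]
    constructor
    · intro h
      have hp : p = p' := by
        have := congrArg π h
        simpa only [hπ.apply_vadd, hπs] using this
      subst hp
      exact ⟨rfl, key.2 h⟩
    · rintro ⟨hp, h⟩
      simp only at hp h
      subst hp
      exact key.1 h

/-- Maps from a compact space to Hausdorff spaces are closed, so both targets are the quotient of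
`X` by the same relation. -/
theorem nonempty_homeomorph_of_eq_iff {X M N : Type*} [TopologicalSpace X] [CompactSpace X]
    [TopologicalSpace M] [T2Space M] [TopologicalSpace N] [T2Space N] {f : X → M} {g : X → N}
    (hf : Continuous f) (hg : Continuous g) (hfs : Function.Surjective f)
    (hgs : Function.Surjective g) (h : ∀ a b, f a = f b ↔ g a = g b) : Nonempty (M ≃ₜ N) := by
  have hfq : IsQuotientMap (⟨f, hf⟩ : C(X, M)) := hf.isClosedMap.isQuotientMap hf hfs
  have hgq : IsQuotientMap (⟨g, hg⟩ : C(X, N)) := hg.isClosedMap.isQuotientMap hg hgs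
  have hker : Setoid.ker (⟨f, hf⟩ : C(X, M)) = Setoid.ker (⟨g, hg⟩ : C(X, N)) :=
    Setoid.ext fun a b => h a b
  have e := hgq.homeomorph
  rw [← hker] at e
  exact ⟨hfq.homeomorph.symm.trans e⟩

theorem charVector_relabel {n : ℕ} {G H : Digraph (Fin n)} {σ : Equiv.Perm (Fin n)}
    (hσ : ∀ i j, G.Adj i j ↔ H.Adj (σ i) (σ j)) (i : Fin n) (c : unitInterval) :
    LinearEquiv.funCongrLeft (ZMod 2) (ZMod 2) σ.symm (G.charVector i c) =
      H.charVector (σ i) c := by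
  ext j
  obtain ⟨k, rfl⟩ := σ.surjective j
  simp only [LinearEquiv.funCongrLeft_apply, LinearMap.funLeft_apply, σ.symm_apply_apply,
    Digraph.charVector]
  split_ifs
  · simp [Pi.single_apply]
  · have h : k = i ∨ G.Adj i k ↔ σ k = σ i ∨ H.Adj (σ i) (σ k) :=
      or_congr σ.injective.eq_iff.symm (hσ i k)
    beta_reduce
    by_cases hk : k = i ∨ G.Adj i k
    · rw [if_pos hk, if_pos (h.1 hk)]
    · rw [if_neg hk, if_neg (hk ∘ h.2)]
  · rfl

theorem charSpan_relabel {n : ℕ} {G H : Digraph (Fin n)} {σ : Equiv.Perm (Fin n)}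
    (hσ : ∀ i j, G.Adj i j ↔ H.Adj (σ i) (σ j)) (p : UnitCube n) :
    charSpan H.charVector (p ∘ σ.symm) = (charSpan G.charVector p).map
      (LinearEquiv.funCongrLeft (ZMod 2) (ZMod 2) σ.symm).toLinearMap := by
  rw [charSpan, charSpan, Submodule.map_span, ← range_comp, ← σ.surjective.range_comp]
  congr 2
  ext1 i
  simp only [Function.comp_apply, σ.symm_apply_apply]
  exact (charVector_relabel hσ i (p i)).symm

/-- Permuting the coordinates of both factors by `σ` carries one gluing relation to the other. -/
theorem IsCubeModel.nonempty_homeomorph {n : ℕ} {M N : Type*} [TopologicalSpace M] [T2Space M]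
    [TopologicalSpace N] [T2Space N] {G H : AcyclicDigraph n} (hGH : G ≈ H)
    {q : UnitCube n × Z2Pow n → M} {r : UnitCube n × Z2Pow n → N}
    (hq : IsCubeModel G.1.charVector q) (hr : IsCubeModel H.1.charVector r) :
    Nonempty (M ≃ₜ N) := by
  obtain ⟨σ, hσ⟩ := hGH
  let Ψ : UnitCube n × Z2Pow n ≃ₜ UnitCube n × Z2Pow n :=
    (Homeomorph.piCongrLeft (Y := fun _ => unitInterval) σ).prodCongr
      (Homeomorph.piCongrLeft (Y := fun _ => ZMod 2) σ)
  have hΨ : ∀ a, Ψ a = (a.1 ∘ σ.symm, LinearEquiv.funCongrLeft (ZMod 2) (ZMod 2) σ.symm a.2) := by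
    intro a
    refine Prod.ext ?_ ?_ <;> ext1 j <;> obtain ⟨k, rfl⟩ := σ.surjective j
    · simp [Ψ]
    · simp [Ψ, LinearMap.funLeft_apply]
  refine nonempty_homeomorph_of_eq_iff hq.continuous (hr.continuous.comp Ψ.continuous)
    hq.surjective (hr.surjective.comp Ψ.surjective) fun a b => ?_
  rw [hq.eq_iff, Function.comp_apply, Function.comp_apply, hr.eq_iff, hΨ, hΨ]
  simp only
  rw [charSpan_relabel hσ, ← map_sub, Submodule.mem_map_equiv, LinearEquiv.symm_apply_apply,
    σ.symm.surjective.injective_comp_right.eq_iff]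

/-! ### From small covers to unlabeled digraphs. -/

theorem SmallCover.exists_isCubeModel {n : ℕ} (M : SmallCover.{u} n) :
    ∃ G : AcyclicDigraph n, ∃ q : UnitCube n × Z2Pow n → M.carrier,
      IsCubeModel G.1.charVector q := by
  have := M.t2Space
  have := M.compactSpace
  let := M.chartedSpace
  let := M.addAction
  have : ContinuousConstVAdd (Z2Pow n) M.carrier := ⟨fun t => (M.smooth_act t).continuous⟩
  obtain ⟨h, hh⟩ := M.orbitSpace
  have hπ : IsCubeOrbitMap fun x : M.carrier =>
      h (Quotient.mk (AddAction.orbitRel (Z2Pow n) M.carrier) x) := by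
    refine ⟨h.isOpenQuotientMap.comp AddAction.isOpenQuotientMap_quotientMk, fun {x y} => ?_, hh,
      fun x => ?_⟩
    · rw [h.injective.eq_iff, Quotient.eq]
      rfl
    · obtain ⟨e, -, φ, he⟩ := M.locallyStandard x
      exact ⟨e, φ, he⟩
  exact hπ.exists_model

instance (n : ℕ) : Finite (AcyclicDigraph n) := by
  have : Function.Injective fun G : AcyclicDigraph n => G.1.Adj := fun G H h =>
    Subtype.ext (Digraph.ext h)
  exact Finite.of_injective _ this

theorem mainTheorem5 (n : ℕ) :
    Finite (SmallCover.HomeoClass.{u} n) ∧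
      Nat.card (SmallCover.HomeoClass.{u} n) ≤ Nat.card (UnlabeledAcyclicDigraph n) := by
  choose G q hq using fun M : SmallCover.{u} n => M.exists_isCubeModel
  have hinj : Function.Injective fun c : SmallCover.HomeoClass.{u} n =>
      (Quotient.mk _ (G c.out) : UnlabeledAcyclicDigraph n) := by
    intro c d hcd
    have := c.out.t2Space
    have := d.out.t2Space
    rw [← c.out_eq, ← d.out_eq]
    exact Quotient.sound ((hq c.out).nonempty_homeomorph (Quotient.exact hcd) (hq d.out))
  exact ⟨Finite.of_injective _ hinj, Nat.card_le_card_of_injective _ hinj⟩
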